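/- A quadratic space over $\mathbb{Q}_2$ is a finite-dimensional $\mathbb{Q}_2$-vector space $V$ with a quadratic map $q : V \to \mathbb{Q}_2$ and the symmetric bilinear form $B$ with $q(v) = B(v,v)$; it is nondegenerate if $B$ is. A $\mathbb{Z}_2$-lattice is a finitely generated $\mathbb{Z}_2$-submodule $L$ of a nondegenerate quadratic space $V$ over $\mathbb{Q}_2$ (it need not span $V$); it is integral if $q(L) \subseteq \mathbb{Z}_2$. A vector $v \in L$ is primitive in $L$ if $\{\alpha \in \mathbb{Q}_2 : \alpha v \in L\} = \mathbb{Z}_2$. An integral $\mathbb{Z}_2$-lattice $L$ is $\mathbb{Z}_2$-universal if $q(L) = \mathbb{Z}_2$, and primitively $\mathbb{Z}_2$-universal if for every nonzero $\alpha \in \mathbb{Z}_2$ there is a vector $v$, primitive in $L$, with $q(v) = \alpha$. Proposition. Let $L$ be an integral $\mathbb{Z}_2$-lattice of rank $n \ge 5$. If $L$ is $\mathbb{Z}_2$-universal, then $L$ is primitively $\mathbb{Z}_2$-universal. -/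

import Mathlib

/-!
Quadratic lattices. `R` is an integral domain with field of fractions `K`, the quadratic space is
a `K`-vector space `V` with a quadratic form `Q`, and a lattice is a finitely generated
`R`-submodule `L` of `V` (not required to span `V`).
-/

namespace QuadLattice

/-- The lattice `L` is integral: `Q(L) ⊆ R`. -/
def IsIntegral {R K V : Type*} [CommRing R] [Field K] [Algebra R K] [AddCommGroup V] [Module K V]
    [Module R V] (Q : QuadraticForm K V) (L : Submodule R V) : Prop :=
  Q '' (L : Set V) ⊆ Set.range (algebraMap R K)

/-- `v` is a primitive vector of `L`: it lies in `L` and `{α ∈ K : α v ∈ L} = R`. -/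
def IsPrimitive {R V : Type*} (K : Type*) [CommRing R] [Field K] [Algebra R K] [AddCommGroup V]
    [Module K V] [Module R V] (L : Submodule R V) (v : V) : Prop :=
  v ∈ L ∧ {α : K | α • v ∈ L} = Set.range (algebraMap R K)

/-- `a` is primitively represented by `L`. -/
def PrimitivelyRepresents {R K V : Type*} [CommRing R] [Field K] [Algebra R K] [AddCommGroup V]
    [Module K V] [Module R V] (Q : QuadraticForm K V) (L : Submodule R V) (a : K) : Prop :=
  ∃ v : V, IsPrimitive K L v ∧ Q v = a

/-- `L` is `R`-universal: `Q(L) = R`. -/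
def IsUniversal {R K V : Type*} [CommRing R] [Field K] [Algebra R K] [AddCommGroup V] [Module K V]
    [Module R V] (Q : QuadraticForm K V) (L : Submodule R V) : Prop :=
  Q '' (L : Set V) = Set.range (algebraMap R K)

/-- `L` is primitively `R`-universal: every nonzero element of `R` is primitively represented. -/
def IsPrimitivelyUniversal {R K V : Type*} [CommRing R] [Field K] [Algebra R K] [AddCommGroup V]
    [Module K V] [Module R V] (Q : QuadraticForm K V) (L : Submodule R V) : Prop :=
  ∀ a : R, a ≠ 0 → PrimitivelyRepresents Q L (algebraMap R K a)

end QuadLattice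

/-!
Let `L` be universal of rank at least `5`. A vector whose value is not divisible by `4` is
automatically primitive, so the values `α` with `4 ∣ α` are at stake. Three mechanisms produce them.

* If `H`, `2H` or `4H` (with `H` the hyperbolic plane `xy`) splits off from `L`, then it represents
  every multiple of `4` with an odd coordinate (`exists_hyperbolic`).
* If a universal form `T` splits off, `L = T ⊥ N` with `N ≠ 0`, then `α - q(n)` is a value of `T`
  for any primitive `n ∈ N`.
* If `L = T ⊥ N` with `N` of rank at least `2`, and `T` represents everything outside a single square
  class `c`, of order `0` or `1`, then some primitive `n ∈ N` has `α - q(n)` among the values of `T`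
  (`exists_isPrim_sub_mem`). Otherwise all the differences `α - q(n)` lie in the class of `c`. A
  quadratic polynomial in one variable that takes only nonzero square values on `ℤ_[2]` is very
  restricted (`eight_dvd_or_of_square_valued`); along the lines in `N` this forces `q(N) ⊆ 8c ℤ_[2]`.
  Then `q(N)` is too small to help in representing `c`, so that universality of `L` makes `T`
  represent `c` itself.

It remains to split off such a form, which takes only the first steps of a Jordan decomposition
(`exists_split_unary`, `exists_split_binary`). Let `A` stand for an anisotropic block
`a s² + b s t + c t²` with `a`, `b`, `c` odd, and `εᵢ` for odd numbers. Universality shows that, unless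
a hyperbolic block is met or `A ⊥ N` has an odd value on `N`, one finds one of the universal forms
`A ⊥ 2A`, `⟨ε₁, 2ε₂⟩ ⊥ 4A`, or one of the ternary forms `A ⊥ ⟨2ε⟩`, `2A ⊥ ⟨ε⟩`, `⟨ε₁, ε₂, ε₃⟩`,
`⟨ε₁, ε₂, 2ε₃⟩`, `⟨ε₁, 2ε₂, 2ε₃⟩`, `⟨ε₁, 2ε₂, 4ε₃⟩`, each of which misses at most one square class.
-/

namespace TwoAdic

open Module QuadraticMap

/-! ### Arithmetic of `ℤ_[2]`: parity, Hensel's lemma, squares -/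

theorem even_or_odd (x : ℤ_[2]) : 2 ∣ x ∨ Odd x := by
  obtain ⟨n, hn, h⟩ := PadicInt.exists_mem_range x
  rw [PadicInt.maximalIdeal_eq_span_p, Ideal.mem_span_singleton] at h
  obtain ⟨k, hk⟩ := h
  push_cast at hk
  interval_cases n
  · exact Or.inl ⟨k, by simpa using hk⟩
  · exact Or.inr ⟨k, by push_cast at hk; linear_combination hk⟩

theorem not_isUnit_two : ¬ IsUnit (2 : ℤ_[2]) := by
  have := PadicInt.prime_p (p := 2)
  exact_mod_cast this.not_isUnit

theorem two_mul_ne_one (x : ℤ_[2]) : 2 * x ≠ 1 := fun h =>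
  not_isUnit_two (IsUnit.of_mul_eq_one _ h)

theorem not_two_dvd_of_odd {x : ℤ_[2]} (h : Odd x) : ¬ 2 ∣ x := by
  rintro ⟨k, rfl⟩
  obtain ⟨m, hm⟩ := h
  exact two_mul_ne_one (k - m) (by linear_combination hm)

theorem isUnit_of_odd {x : ℤ_[2]} (h : Odd x) : IsUnit x := by
  by_contra hx
  have h1 : x ∈ IsLocalRing.maximalIdeal ℤ_[2] := hx
  rw [PadicInt.maximalIdeal_eq_span_p, Ideal.mem_span_singleton] at h1
  exact not_two_dvd_of_odd h (by exact_mod_cast h1)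

/-- Hensel's lemma for a quadratic polynomial whose derivative is odd. -/
theorem exists_root (a b e : ℤ_[2]) (hb : Odd b) (he : 2 ∣ e) :
    ∃ x, a * x ^ 2 + b * x + e = 0 := by
  open Polynomial in
  let F : ℤ_[2][X] := C a * X ^ 2 + C b * X + C e
  have h0 : Polynomial.aeval (0 : ℤ_[2]) F = e := by simp [F]
  have h1 : Polynomial.aeval (0 : ℤ_[2]) (Polynomial.derivative F) = b := by simp [F]
  have hb' : ‖b‖ = 1 := PadicInt.isUnit_iff.1 (isUnit_of_odd hb)
  have he' : ‖e‖ < 1 := by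
    obtain ⟨k, rfl⟩ := he
    refine PadicInt.mem_nonunits.1 fun h => not_isUnit_two (isUnit_of_mul_isUnit_left h)
  obtain ⟨z, hz, -⟩ := hensels_lemma (F := F) (a := 0) (by rw [h0, h1, hb']; simpa using he')
  exact ⟨z, by simpa [F] using hz⟩

theorem exists_odd_sq_eq (k : ℤ_[2]) : ∃ w : ℤ_[2], Odd w ∧ w ^ 2 = 1 + 8 * k := by
  obtain ⟨x, hx⟩ := exists_root 1 1 (-2 * k) odd_one ⟨-k, by ring⟩
  exact ⟨2 * x + 1, ⟨x, rfl⟩, by linear_combination 4 * hx⟩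

theorem odd_sq_eq {x : ℤ_[2]} (h : Odd x) : ∃ k, x ^ 2 = 1 + 8 * k := by
  obtain ⟨m, rfl⟩ := h
  rcases even_or_odd m with ⟨j, rfl⟩ | ⟨j, rfl⟩
  · exact ⟨j * (2 * j + 1), by ring⟩
  · exact ⟨(2 * j + 1) * (j + 1), by ring⟩

theorem four_dvd_or_of_isSquare {x : ℤ_[2]} (h : IsSquare x) : 4 ∣ x ∨ ∃ k, x = 1 + 8 * k := by
  obtain ⟨y, rfl⟩ := h
  rcases even_or_odd y with ⟨k, rfl⟩ | hy
  · exact Or.inl ⟨k * k, by ring⟩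
  · obtain ⟨k, hk⟩ := odd_sq_eq hy
    exact Or.inr ⟨k, by rw [← hk]; ring⟩

/-- An odd square is `1` modulo `8`, with one factor `2` cancelled from the difference. -/
theorem eight_dvd_of_isSquare {x : ℤ_[2]} (h : IsSquare (1 + 2 * x)) : 4 ∣ x := by
  rcases four_dvd_or_of_isSquare h with ⟨k, hk⟩ | ⟨k, hk⟩
  · exact absurd (show 2 * (2 * k - x) = 1 by linear_combination -hk) (two_mul_ne_one _)
  · exact ⟨k, mul_left_cancel₀ (two_ne_zero) (by linear_combination hk)⟩

theorem isSquare_of_sq_mul {s m z : ℤ_[2]} (hs : s ≠ 0) (h : s ^ 2 * m = z ^ 2) : IsSquare m := by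
  have h1 : s ∣ z := by
    have : s ^ 2 ∣ z ^ 2 := ⟨m, h.symm⟩
    exact (IsIntegrallyClosed.pow_dvd_pow_iff two_ne_zero).1 this
  obtain ⟨t, rfl⟩ := h1
  exact ⟨t, mul_left_cancel₀ (pow_ne_zero 2 hs) (by rw [h]; ring)⟩

/-- When the constant term is `s²` and `8 s` divides the linear coefficient, the values at `s` and
`2s` already force the leading coefficient to be divisible by `8`. -/
theorem eight_dvd_of_square_valued_aux {A b s : ℤ_[2]} (hs : s ≠ 0)
    (h : ∀ y, ∃ z, A * y ^ 2 + 8 * s * b * y + s ^ 2 = z ^ 2) : 8 ∣ A := by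
  obtain ⟨z, hz⟩ := h (2 * s)
  have h2 : 4 ∣ 2 * A + 8 * b :=
    eight_dvd_of_isSquare (isSquare_of_sq_mul hs (z := z) (by rw [← hz]; ring))
  obtain ⟨k, hk⟩ := h2
  have hA : A = 2 * (k - 2 * b) := mul_left_cancel₀ two_ne_zero (by linear_combination hk)
  obtain ⟨z, hz⟩ := h s
  have h1 : 4 ∣ (k - 2 * b) + 4 * b :=
    eight_dvd_of_isSquare (isSquare_of_sq_mul hs (z := z) (by rw [← hz, hA]; ring))
  obtain ⟨l, hl⟩ := h1
  exact ⟨l - b, by rw [hA]; linear_combination 2 * hl⟩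

/-- If the vertex `y₀` is integral, completing the square removes the linear term. -/
theorem eight_dvd_of_vertex {A B C y₀ : ℤ_[2]} (hy : 2 * A * y₀ = -B)
    (h : ∀ y, ∃ z ≠ 0, A * y ^ 2 + B * y + C = z ^ 2) : 8 ∣ A := by
  obtain ⟨s, hs, hs'⟩ := h y₀
  refine eight_dvd_of_square_valued_aux (b := 0) hs fun y => ?_
  obtain ⟨z, -, hz⟩ := h (y + y₀)
  exact ⟨z, by rw [← hz, ← hs']; linear_combination -y * hy⟩

/-- A quadratic polynomial all of whose values on `ℤ_[2]` are nonzero squares has leading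
coefficient divisible by `8`, unless it looks like `(2y + 1)²`. -/
theorem eight_dvd_or_of_square_valued {A B C : ℤ_[2]}
    (h : ∀ y, ∃ z ≠ 0, A * y ^ 2 + B * y + C = z ^ 2) : 8 ∣ A ∨ (Odd C ∧ 4 ∣ A) := by
  obtain ⟨s, hs, hC⟩ := h 0
  have hC : C = s ^ 2 := by linear_combination hC
  subst hC
  -- the cases are `B ∣ s`, then `B = s k` with `k` exactly divisible by `1`, `2`, `4`, or by `8`
  rcases ValuationRing.dvd_total B s with ⟨t, rfl⟩ | ⟨k, rfl⟩
  · -- the value at `4 s t` is `s² (5 + 16 A t²)`, and no square is `5` modulo `8`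
    obtain ⟨z, -, hz⟩ := h (4 * (B * t) * t)
    obtain ⟨k, hk⟩ : 4 ∣ 2 + 8 * A * t ^ 2 :=
      eight_dvd_of_isSquare (isSquare_of_sq_mul hs (z := z) (by rw [← hz]; ring))
    refine absurd (mul_left_cancel₀ two_ne_zero ?_) (two_mul_ne_one (k - 2 * A * t ^ 2))
    linear_combination -hk
  have key : ∀ t, ∃ z : ℤ_[2], s ^ 2 * (1 + k * t + A * t ^ 2) = z ^ 2 := fun t => by
    obtain ⟨z, -, hz⟩ := h (s * t)
    exact ⟨z, by rw [← hz]; ring⟩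
  rcases even_or_odd k with ⟨k, rfl⟩ | hk
  swap
  · obtain ⟨u, hu⟩ := (isUnit_of_odd hk).exists_right_inv
    obtain ⟨z, hz⟩ := key (4 * u)
    obtain ⟨j, hj⟩ : 4 ∣ 2 + 8 * A * u ^ 2 :=
      eight_dvd_of_isSquare (isSquare_of_sq_mul hs (z := z)
        (by linear_combination hz - 4 * s ^ 2 * hu))
    refine absurd (mul_left_cancel₀ two_ne_zero ?_) (two_mul_ne_one (j - 2 * A * u ^ 2))
    linear_combination -hj
  obtain ⟨z, hz⟩ := key 2
  obtain ⟨j, hj⟩ : 4 ∣ 2 * k + 2 * A :=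
    eight_dvd_of_isSquare (isSquare_of_sq_mul hs (z := z) (by rw [← hz]; ring))
  have hA : A = 2 * j - k := mul_left_cancel₀ two_ne_zero (by linear_combination hj)
  rcases even_or_odd k with ⟨k, rfl⟩ | hk
  swap
  · have hAo : Odd A := by
      obtain ⟨i, rfl⟩ := hk
      exact ⟨j - i - 1, by rw [hA]; ring⟩
    obtain ⟨u, hu⟩ := (isUnit_of_odd hAo).exists_right_inv
    exact Or.inl (eight_dvd_of_vertex (y₀ := -(s * k * u))
      (by linear_combination -2 * s * k * hu) h)
  rcases even_or_odd k with ⟨k, rfl⟩ | hk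
  · refine Or.inl (eight_dvd_of_square_valued_aux (b := k) hs fun y => ?_)
    obtain ⟨z, -, hz⟩ := h y
    exact ⟨z, by rw [← hz]; ring⟩
  obtain ⟨z, hz⟩ := key 1
  obtain ⟨i, hi⟩ : 4 ∣ k + j :=
    eight_dvd_of_isSquare (isSquare_of_sq_mul hs (z := z) (by rw [← hz, hA]; ring))
  have hA' : A = 4 * (2 * i - k) := by rw [hA]; linear_combination 2 * hi
  rcases even_or_odd s with ⟨s, rfl⟩ | hso
  · have hao : Odd (2 * i - k) := by
      obtain ⟨l, rfl⟩ := hk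
      exact ⟨i - l - 1, by ring⟩
    obtain ⟨u, hu⟩ := (isUnit_of_odd hao).exists_right_inv
    exact Or.inl (eight_dvd_of_vertex (y₀ := -(s * k * u))
      (by rw [hA']; linear_combination -8 * s * k * hu) h)
  · exact Or.inr ⟨hso.pow, _, hA'⟩

/-! ### Primitive vectors and quadratic forms with values in one square class -/

section

variable {M : Type*} [AddCommGroup M] [Module ℤ_[2] M]

/-- `v` is not divisible by `2` in `M`. -/
def IsPrim (v : M) : Prop := ¬ ∃ w : M, v = (2 : ℤ_[2]) • w

/-- `q` takes the value `a` at a primitive vector. -/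
def PrimRep (q : QuadraticForm ℤ_[2] M) (a : ℤ_[2]) : Prop := ∃ v : M, IsPrim v ∧ q v = a

theorem map_smul_add (q : QuadraticForm ℤ_[2] M) (s : ℤ_[2]) (u n : M) :
    q (s • u + n) = q u * s ^ 2 + s * polar q u n + q n := by
  have h : polar q (s • u) n = s * polar q u n := by simp [polar_smul_left]
  have h2 := q.map_smul s u
  simp only [polar, smul_eq_mul] at h h2 ⊢
  linear_combination h + h2

theorem map_two_smul (q : QuadraticForm ℤ_[2] M) (w : M) : q ((2 : ℤ_[2]) • w) = 4 * q w := by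
  rw [q.map_smul, smul_eq_mul]; ring

theorem isPrim_of_not_four_dvd {q : QuadraticForm ℤ_[2] M} {v : M} (h : ¬ 4 ∣ q v) :
    IsPrim v := by
  rintro ⟨w, rfl⟩
  exact h ⟨_, map_two_smul q w⟩

theorem isPrim_of_odd_repr {ι : Type*} (b : Basis ι ℤ_[2] M) {v : M} (i : ι)
    (h : Odd (b.repr v i)) : IsPrim v := by
  rintro ⟨w, rfl⟩
  refine not_two_dvd_of_odd h ⟨b.repr w i, by simp⟩

theorem IsPrim.exists_odd_repr {ι : Type*} [Fintype ι] (b : Basis ι ℤ_[2] M) {v : M}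
    (h : IsPrim v) : ∃ i, Odd (b.repr v i) := by
  by_contra! hc
  have h2 : ∀ i, ∃ k, b.repr v i = 2 * k := fun i => (even_or_odd _).resolve_right (hc i)
  choose k hk using h2
  refine h ⟨∑ i, k i • b i, ?_⟩
  rw [← b.sum_repr v, Finset.smul_sum]
  exact Finset.sum_congr rfl fun i _ => by rw [hk, mul_smul]

theorem eight_mul_dvd_of_isPrim {q : QuadraticForm ℤ_[2] M} {c : ℤ_[2]} (hc : c ∣ 2)
    (h : ∀ n, IsPrim n → 8 * c ∣ q n) (n : M) : 8 * c ∣ q n := by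
  by_cases hn : IsPrim n
  · exact h n hn
  obtain ⟨w, rfl⟩ := not_not.1 hn
  rw [map_two_smul]
  by_cases hw : IsPrim w
  · exact (h w hw).mul_left 4
  obtain ⟨w, rfl⟩ := not_not.1 hw
  obtain ⟨d, hd⟩ := hc
  exact ⟨d * q w, by rw [map_two_smul]; linear_combination 8 * q w * hd⟩

variable [Module.Free ℤ_[2] M] [Module.Finite ℤ_[2] M]

theorem exists_isPrim (h : 1 ≤ finrank ℤ_[2] M) : ∃ v : M, IsPrim v := by
  refine ⟨finBasis ℤ_[2] M ⟨0, h⟩, isPrim_of_odd_repr (finBasis ℤ_[2] M) ⟨0, h⟩ ?_⟩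
  simp

/-- In rank at least `2`, a primitive vector is part of a pair whose combinations with one
coefficient equal to `1` are all primitive. -/
theorem IsPrim.exists_partner (h : 2 ≤ finrank ℤ_[2] M) {v : M} (hv : IsPrim v) :
    ∃ e : M, (∀ y : ℤ_[2], IsPrim (y • e + v)) ∧ ∀ y : ℤ_[2], IsPrim (y • v + e) := by
  let b := finBasis ℤ_[2] M
  have : Nontrivial (Fin (finrank ℤ_[2] M)) := Fin.nontrivial_iff_two_le.2 h
  obtain ⟨i, hi⟩ := hv.exists_odd_repr b
  obtain ⟨j, hj⟩ := exists_ne i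
  refine ⟨b j, fun y => isPrim_of_odd_repr b i (by simpa [Finsupp.single_apply, hj] using hi),
    fun y => ?_⟩
  rcases even_or_odd y with hy | hy
  · refine isPrim_of_odd_repr b j ?_
    obtain ⟨k, rfl⟩ := hy
    exact ⟨k * b.repr v j, by simp; ring⟩
  · exact isPrim_of_odd_repr b i (by simpa [Finsupp.single_apply, hj] using hy.mul hi)

/-- If all the differences `α - q n`, for `n` primitive, lie in the square class of `c`, then `q`
vanishes modulo `8c`. -/
theorem eight_mul_dvd_of_squareClass {q : QuadraticForm ℤ_[2] M} (hM : 2 ≤ finrank ℤ_[2] M)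
    {c α : ℤ_[2]} (hc0 : c ≠ 0) (hc : c ∣ 2) (hα : 4 ∣ α)
    (h : ∀ n : M, IsPrim n → ∃ z ≠ 0, α - q n = c * z ^ 2) (n : M) : 8 * c ∣ q n := by
  refine eight_mul_dvd_of_isPrim hc (fun n hn => ?_) n
  obtain ⟨d, hd⟩ := hc
  obtain ⟨β, rfl⟩ := hα
  -- divide everything by `c`; the quotient `2 * (d * β)` of `α` is even
  have hq : ∀ n : M, IsPrim n → ∃ r, q n = c * r := fun n hn => by
    obtain ⟨z, -, hz⟩ := h n hn
    exact ⟨2 * (d * β) - z ^ 2, by linear_combination -hz + 2 * β * hd⟩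
  obtain ⟨e, hne, hen⟩ := hn.exists_partner hM
  have he : IsPrim e := by simpa using hen 0
  obtain ⟨r, hr⟩ := hq n hn
  obtain ⟨r', hr'⟩ := hq e he
  obtain ⟨t, ht⟩ := hq _ (hne 1)
  obtain ⟨p, hp⟩ : ∃ p, polar q e n = c * p := by
    rw [map_smul_add] at ht
    exact ⟨t - r - r', by linear_combination ht - hr - hr'⟩
  have hp' : polar q n e = c * p := by rw [← hp, polar_comm]
  have line : ∀ {a b : M} {s s' : ℤ_[2]}, q a = c * s → q b = c * s' → polar q a b = c * p →
      (∀ y : ℤ_[2], IsPrim (y • a + b)) →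
      8 ∣ -s ∨ (Odd (2 * (d * β) - s') ∧ 4 ∣ -s) := by
    intro a b s s' ha hb hab hprim
    refine eight_dvd_or_of_square_valued (B := -p) fun y => ?_
    obtain ⟨z, hz0, hz⟩ := h _ (hprim y)
    rw [map_smul_add, ha, hb, hab] at hz
    exact ⟨z, hz0, mul_left_cancel₀ hc0 (by linear_combination hz - 2 * β * hd)⟩
  have h4 : 4 ∣ -r' := by
    rcases line hr' hr hp hne with h8 | ⟨-, h4⟩
    · exact (Dvd.intro 2 (by norm_num)).trans h8
    · exact h4
  rcases line hr hr' hp' hen with ⟨k, hk⟩ | ⟨hodd, -⟩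
  · exact ⟨-k, by rw [hr]; linear_combination -c * hk⟩
  · obtain ⟨k, hk⟩ := h4
    exact absurd ⟨d * β + 2 * k, by linear_combination hk⟩ (not_two_dvd_of_odd hodd)

/-- An element congruent to `r` modulo `8` times itself lies in the square class of `r`. -/
theorem mem_of_eight_mul_dvd {R : Set ℤ_[2]} (hR : ∀ r ∈ R, ∀ z, r * z ^ 2 ∈ R) {r γ : ℤ_[2]}
    (hr : r ∈ R) (h : 8 * γ ∣ γ - r) : γ ∈ R := by
  obtain ⟨k, hk⟩ := h
  obtain ⟨w, hw, hw2⟩ := exists_odd_sq_eq (-k)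
  obtain ⟨u, hu⟩ := (isUnit_of_odd hw).exists_right_inv
  have : γ = r * u ^ 2 := by
    have h1 : r = γ * w ^ 2 := by rw [hw2]; linear_combination -hk
    rw [h1]; linear_combination -γ * (w * u + 1) * hu
  rw [this]
  exact hR r hr u

/-- Let `R` be a set of values, stable under multiplication by squares, that misses at most the
square class of `c`. If `R + q` is universal and `4 ∣ α`, then `α` is the sum of an element of `R`
and a value of `q` at a primitive vector. -/
theorem exists_isPrim_sub_mem {q : QuadraticForm ℤ_[2] M} (hM : 2 ≤ finrank ℤ_[2] M)
    {R : Set ℤ_[2]} (hR : ∀ r ∈ R, ∀ z, r * z ^ 2 ∈ R) {c : ℤ_[2]} (hc0 : c ≠ 0) (hc : c ∣ 2)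
    (hRc : ∀ γ, γ ∈ R ∨ ∃ z ≠ 0, γ = c * z ^ 2) (huniv : ∃ r ∈ R, ∃ n, c = r + q n)
    {α : ℤ_[2]} (hα : 4 ∣ α) : ∃ r ∈ R, ∃ n, IsPrim n ∧ α = r + q n := by
  by_contra! hcon
  have h : ∀ n : M, IsPrim n → ∃ z ≠ 0, α - q n = c * z ^ 2 := fun n hn =>
    (hRc _).resolve_left fun hm => hcon _ hm n hn (by ring)
  obtain ⟨r, hr, n, hn⟩ := huniv
  have hcR : c ∈ R := by
    refine mem_of_eight_mul_dvd hR hr ?_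
    rw [show c - r = q n by rw [hn]; ring]
    exact eight_mul_dvd_of_squareClass hM hc0 hc hα h n
  obtain ⟨v, hv⟩ := exists_isPrim (M := M) (by omega)
  obtain ⟨z, -, hz⟩ := h v hv
  exact hcon _ (hR c hcR z) v hv (by rw [← hz]; ring)

end

/-! ### Binary blocks and sets of values stable under squares -/

theorem two_dvd_sub {x y : ℤ_[2]} (hx : Odd x) (hy : Odd y) : 2 ∣ x - y := by
  obtain ⟨k, rfl⟩ := hx
  obtain ⟨l, rfl⟩ := hy
  exact ⟨k - l, by ring⟩

/-- A block with `b` odd and `a` even or `c` even is a hyperbolic plane: it represents everything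
with an odd coordinate. -/
theorem exists_hyperbolic {a b c : ℤ_[2]} (hb : Odd b) (h : 2 ∣ a ∨ 2 ∣ c) (α : ℤ_[2]) :
    ∃ s t, (Odd s ∨ Odd t) ∧ a * s ^ 2 + b * s * t + c * t ^ 2 = α := by
  have key : ∀ a c : ℤ_[2], 2 ∣ a →
      ∃ s t, (Odd s ∨ Odd t) ∧ a * s ^ 2 + b * s * t + c * t ^ 2 = α := by
    intro a c ha
    by_cases hα : 2 ∣ α
    · obtain ⟨y, hy⟩ := exists_root c b (a - α) hb (dvd_sub ha hα)
      exact ⟨1, y, Or.inl odd_one, by linear_combination hy⟩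
    have hα := (even_or_odd α).resolve_left hα
    rcases even_or_odd c with hc | hc
    · -- replace the second basis vector by the sum of the two, whose value is odd
      obtain ⟨x, hx⟩ := exists_root a (b + 2 * a) (a + b + c - α)
        (by obtain ⟨k, rfl⟩ := hb; exact ⟨k + a, by ring⟩) (by
          obtain ⟨i, rfl⟩ := ha
          obtain ⟨j, rfl⟩ := hc
          obtain ⟨k, hk⟩ := two_dvd_sub hb hα
          exact ⟨i + j + k, by linear_combination hk⟩)
      exact ⟨x + 1, 1, Or.inr odd_one, by linear_combination hx⟩
    · obtain ⟨x, hx⟩ := exists_root a b (c - α) hb (two_dvd_sub hc hα)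
      exact ⟨x, 1, Or.inr odd_one, by linear_combination hx⟩
  rcases h with h | h
  · exact key a c h
  · obtain ⟨s, t, hst, he⟩ := key c a h
    exact ⟨t, s, hst.symm, by rw [← he]; ring⟩

/-- A block with `b` and `c` odd represents every odd number. -/
theorem exists_of_odd {a b c δ : ℤ_[2]} (hb : Odd b) (hc : Odd c) (hδ : Odd δ) :
    ∃ s, a * s ^ 2 + b * s * 1 + c * 1 ^ 2 = δ := by
  obtain ⟨x, hx⟩ := exists_root a b (c - δ) hb (two_dvd_sub hc hδ)
  exact ⟨x, by linear_combination hx⟩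

theorem even_of_block_even {a b c s t : ℤ_[2]} (ha : Odd a) (hb : Odd b) (hc : Odd c)
    (h : 2 ∣ a * s ^ 2 + b * s * t + c * t ^ 2) : 2 ∣ s ∧ 2 ∣ t := by
  rcases even_or_odd s with hs | hs <;> rcases even_or_odd t with ht | ht
  · exact ⟨hs, ht⟩
  all_goals
    exfalso
    refine not_two_dvd_of_odd ?_ h
    obtain ⟨a, rfl⟩ := ha
    obtain ⟨b, rfl⟩ := hb
    obtain ⟨c, rfl⟩ := hc
    obtain ⟨s, rfl⟩ := hs
    obtain ⟨t, rfl⟩ := ht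
  · exact ⟨a * 4 * s ^ 2 + 2 * s ^ 2 + b * 2 * s * (2 * t + 1) + s * (2 * t + 1) +
      c * (2 * t + 1) ^ 2 + 2 * t ^ 2 + 2 * t, by ring⟩
  · exact ⟨c * 4 * t ^ 2 + 2 * t ^ 2 + b * 2 * t * (2 * s + 1) + t * (2 * s + 1) +
      a * (2 * s + 1) ^ 2 + 2 * s ^ 2 + 2 * s, by ring⟩
  · exact ⟨a * (2 * s + 1) ^ 2 + b * (2 * s + 1) * (2 * t + 1) + c * (2 * t + 1) ^ 2 +
      2 * s ^ 2 + 2 * s + 2 * s * t + s + t + 2 * t ^ 2 + 2 * t + 1, by ring⟩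

theorem odd_or_two_mul_odd {γ : ℤ_[2]} (h : ¬ 4 ∣ γ) : Odd γ ∨ ∃ δ, Odd δ ∧ γ = 2 * δ := by
  rcases even_or_odd γ with ⟨δ, rfl⟩ | h1
  · refine Or.inr ⟨δ, (even_or_odd δ).resolve_left ?_, rfl⟩
    rintro ⟨k, rfl⟩
    exact h ⟨k, by ring⟩
  · exact Or.inl h1

theorem exists_eq_mul_sq {γ : ℤ_[2]} (h0 : γ ≠ 0) : ∃ z γ₀, z ≠ 0 ∧ ¬ 4 ∣ γ₀ ∧ γ = γ₀ * z ^ 2 := by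
  have h4 : ¬ IsUnit (4 : ℤ_[2]) := fun h =>
    not_isUnit_two (isUnit_of_mul_isUnit_left (y := 2) (by norm_num; exact h))
  obtain ⟨c, hc, hn⟩ := (FiniteMultiplicity.of_not_isUnit h4 h0).exists_eq_pow_mul_and_not_dvd
  generalize multiplicity 4 γ = m at hc
  subst hc
  refine ⟨2 ^ m, c, pow_ne_zero _ two_ne_zero, hn, ?_⟩
  rw [← pow_mul, mul_comm m 2, pow_mul]
  norm_num [mul_comm]

/-- A set stable under multiplication by squares is determined, up to one square class, by its
elements of order at most `1`. -/
theorem mem_or_of_not_four_dvd {R : Set ℤ_[2]} (hR : ∀ r ∈ R, ∀ z, r * z ^ 2 ∈ R) (h0 : 0 ∈ R)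
    {c : ℤ_[2]} (h : ∀ γ, ¬ 4 ∣ γ → γ ∈ R ∨ ∃ z ≠ 0, γ = c * z ^ 2) (γ : ℤ_[2]) :
    γ ∈ R ∨ ∃ z ≠ 0, γ = c * z ^ 2 := by
  by_cases hγ : γ = 0
  · exact Or.inl (hγ ▸ h0)
  obtain ⟨z, γ₀, hz, h4, rfl⟩ := exists_eq_mul_sq hγ
  rcases h γ₀ h4 with h | ⟨w, hw, rfl⟩
  · exact Or.inl (hR _ h z)
  · exact Or.inr ⟨w * z, mul_ne_zero hw hz, by ring⟩

theorem mem_of_forall_not_four_dvd {R : Set ℤ_[2]} (hR : ∀ r ∈ R, ∀ z, r * z ^ 2 ∈ R)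
    (h0 : 0 ∈ R) (h : ∀ γ, ¬ 4 ∣ γ → γ ∈ R) (γ : ℤ_[2]) : γ ∈ R := by
  by_cases hγ : γ = 0
  · exact hγ ▸ h0
  obtain ⟨z, γ₀, -, h4, rfl⟩ := exists_eq_mul_sq hγ
  exact hR _ (h γ₀ h4) z

/-- The square classes of odd numbers are those of `1`, `3`, `5` and `7`. -/
theorem exists_odd_class {x : ℤ_[2]} (hx : Odd x) :
    ∃ d ∈ ({1, 3, 5, 7} : Finset ℕ), ∃ w, Odd w ∧ x = d * w ^ 2 := by
  have key : ∃ d ∈ ({1, 3, 5, 7} : Finset ℕ), 8 ∣ x - d := by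
    obtain ⟨k, rfl⟩ := hx
    rcases even_or_odd k with ⟨k, rfl⟩ | ⟨k, rfl⟩ <;>
    rcases even_or_odd k with ⟨k, rfl⟩ | ⟨k, rfl⟩
    · exact ⟨1, by simp, k, by push_cast; ring⟩
    · exact ⟨5, by simp, k, by push_cast; ring⟩
    · exact ⟨3, by simp, k, by push_cast; ring⟩
    · exact ⟨7, by simp, k, by push_cast; ring⟩
  obtain ⟨d, hd, k, hk⟩ := key
  have hdo : Odd (d : ℤ_[2]) := by
    have : Odd d := by
      simp only [Finset.mem_insert, Finset.mem_singleton] at hd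
      rcases hd with rfl | rfl | rfl | rfl <;> decide
    exact this.natCast
  obtain ⟨u, hu⟩ := (isUnit_of_odd hdo).exists_right_inv
  obtain ⟨w, hw, hw2⟩ := exists_odd_sq_eq (k * u)
  exact ⟨d, hd, w, hw, by rw [hw2]; linear_combination hk - 8 * k * hu⟩

/-! ### Ternary forms missing at most one square class -/

/-- The values of `p (a s² + b s t + c t²) + ε z²`. -/
def blockValues (p a b c ε : ℤ_[2]) : Set ℤ_[2] :=
  {r | ∃ s t z, r = p * (a * s ^ 2 + b * s * t + c * t ^ 2) + ε * z ^ 2}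

/-- The values of `a x² + b y² + c z²`. -/
def diagValues (a b c : ℤ_[2]) : Set ℤ_[2] :=
  {r | ∃ x y z, r = a * x ^ 2 + b * y ^ 2 + c * z ^ 2}

theorem blockValues_mul_sq {p a b c ε : ℤ_[2]} :
    ∀ r ∈ blockValues p a b c ε, ∀ w, r * w ^ 2 ∈ blockValues p a b c ε := by
  rintro _ ⟨s, t, z, rfl⟩ w
  exact ⟨s * w, t * w, z * w, by ring⟩

theorem diagValues_mul_sq {a b c : ℤ_[2]} :
    ∀ r ∈ diagValues a b c, ∀ w, r * w ^ 2 ∈ diagValues a b c := by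
  rintro _ ⟨x, y, z, rfl⟩ w
  exact ⟨x * w, y * w, z * w, by ring⟩

theorem odd_five_mul {ε : ℤ_[2]} (hε : Odd ε) : Odd (5 * ε) := by
  obtain ⟨k, rfl⟩ := hε
  exact ⟨5 * k + 2, by ring⟩

/-- Two odd numbers are congruent modulo `8`, or lie in square classes differing by `5`, or differ
by twice an odd number. -/
theorem odd_trichotomy {ε δ : ℤ_[2]} (hε : Odd ε) (hδ : Odd δ) :
    8 * δ ∣ δ - ε ∨ (∃ w, w ≠ 0 ∧ δ = 5 * ε * w ^ 2) ∨ ∃ k, Odd k ∧ δ - ε = 2 * k := by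
  obtain ⟨k, hk⟩ := two_dvd_sub hδ hε
  rcases even_or_odd k with ⟨k, rfl⟩ | hk'
  swap
  · exact Or.inr (Or.inr ⟨k, hk', hk⟩)
  rcases even_or_odd k with ⟨k, rfl⟩ | hk'
  · obtain ⟨u, hu⟩ := (isUnit_of_odd hδ).exists_right_inv
    exact Or.inl ⟨u * k, by linear_combination hk - 8 * k * hu⟩
  · obtain ⟨i, hi⟩ := two_dvd_sub hk' hε
    obtain ⟨u, hu⟩ := (isUnit_of_odd (odd_five_mul hε)).exists_right_inv
    obtain ⟨w, hw, hw2⟩ := exists_odd_sq_eq (i * u)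
    refine Or.inr (Or.inl ⟨w, ?_, by rw [hw2]; linear_combination hk + 4 * hi - 8 * i * hu⟩)
    rintro rfl
    exact not_two_dvd_of_odd hw (dvd_zero 2)

theorem dvd_two_of_odd {ε : ℤ_[2]} (hε : Odd ε) : ε ∣ 2 ∧ 2 * ε ∣ 2 := by
  obtain ⟨u, hu⟩ := (isUnit_of_odd hε).exists_right_inv
  exact ⟨⟨2 * u, by linear_combination -2 * hu⟩, ⟨u, by linear_combination -2 * hu⟩⟩

theorem ne_zero_of_odd {ε : ℤ_[2]} (hε : Odd ε) : ε ≠ 0 := by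
  rintro rfl
  exact not_two_dvd_of_odd hε (dvd_zero 2)

/-- A block with `b`, `c` odd and `⟨2ε⟩` together miss at most the square class of `10 ε`. -/
theorem blockValues_one {a b c ε : ℤ_[2]} (hb : Odd b) (hc : Odd c) (hε : Odd ε) (γ : ℤ_[2]) :
    γ ∈ blockValues 1 a b c (2 * ε) ∨ ∃ z ≠ 0, γ = 2 * (5 * ε) * z ^ 2 := by
  refine mem_or_of_not_four_dvd blockValues_mul_sq ⟨0, 0, 0, by ring⟩ (fun γ hγ => ?_) γ
  rcases odd_or_two_mul_odd hγ with hγ | ⟨δ, hδ, rfl⟩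
  · obtain ⟨s, hs⟩ := exists_of_odd (a := a) hb hc hγ
    exact Or.inl ⟨s, 1, 0, by rw [hs]; ring⟩
  · rcases odd_trichotomy hε hδ with ⟨k, hk⟩ | ⟨w, hw, h⟩ | ⟨k, hk, h⟩
    · exact Or.inl (mem_of_eight_mul_dvd blockValues_mul_sq (r := 2 * ε) ⟨0, 0, 1, by ring⟩
        ⟨k, by linear_combination 2 * hk⟩)
    · exact Or.inr ⟨w, hw, by rw [h]; ring⟩
    · obtain ⟨s, hs⟩ := exists_of_odd (a := a) hb hc hk
      exact Or.inl ⟨2 * s, 2, 1, by linear_combination 2 * h - 4 * hs⟩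

/-- Twice a block with `b`, `c` odd and `⟨ε⟩` together miss at most the square class of `5 ε`. -/
theorem blockValues_two {a b c ε : ℤ_[2]} (hb : Odd b) (hc : Odd c) (hε : Odd ε) (γ : ℤ_[2]) :
    γ ∈ blockValues 2 a b c ε ∨ ∃ z ≠ 0, γ = 5 * ε * z ^ 2 := by
  refine mem_or_of_not_four_dvd blockValues_mul_sq ⟨0, 0, 0, by ring⟩ (fun γ hγ => ?_) γ
  rcases odd_or_two_mul_odd hγ with hγ | ⟨δ, hδ, rfl⟩
  · rcases odd_trichotomy hε hγ with h | h | ⟨k, hk, h⟩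
    · exact Or.inl (mem_of_eight_mul_dvd blockValues_mul_sq ⟨0, 0, 1, by ring⟩ h)
    · exact Or.inr h
    · obtain ⟨s, hs⟩ := exists_of_odd (a := a) hb hc hk
      exact Or.inl ⟨s, 1, 1, by linear_combination h - 2 * hs⟩
  · obtain ⟨s, hs⟩ := exists_of_odd (a := a) hb hc hδ
    exact Or.inl ⟨s, 1, 0, by rw [hs]; ring⟩

theorem two_blocks_universal {a b c a' b' c' : ℤ_[2]} (hb : Odd b) (hc : Odd c) (hb' : Odd b')
    (hc' : Odd c') (γ : ℤ_[2]) : ∃ s t s' t', γ = 1 * (a * s ^ 2 + b * s * t + c * t ^ 2) +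
      2 * (a' * s' ^ 2 + b' * s' * t' + c' * t' ^ 2) := by
  refine mem_of_forall_not_four_dvd (R := {γ | ∃ s t s' t',
    γ = 1 * (a * s ^ 2 + b * s * t + c * t ^ 2) +
      2 * (a' * s' ^ 2 + b' * s' * t' + c' * t' ^ 2)}) ?_ ⟨0, 0, 0, 0, by ring⟩ (fun γ hγ => ?_) γ
  · rintro _ ⟨s, t, s', t', rfl⟩ w
    exact ⟨s * w, t * w, s' * w, t' * w, by ring⟩
  rcases odd_or_two_mul_odd hγ with hγ | ⟨δ, hδ, rfl⟩
  · obtain ⟨s, hs⟩ := exists_of_odd (a := a) hb hc hγ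
    exact ⟨s, 1, 0, 0, by rw [hs]; ring⟩
  · obtain ⟨s, hs⟩ := exists_of_odd (a := a') hb' hc' hδ
    exact ⟨0, 0, s, 1, by rw [hs]; ring⟩

theorem diag_add_block_universal {ε₁ ε₂ a b c : ℤ_[2]} (h₁ : Odd ε₁) (h₂ : Odd ε₂) (hb : Odd b)
    (hc : Odd c) (γ : ℤ_[2]) : ∃ x y s t, γ = ε₁ * x ^ 2 + 2 * ε₂ * y ^ 2 +
      4 * (a * s ^ 2 + b * s * t + c * t ^ 2) := by
  let R : Set ℤ_[2] := {γ | ∃ x y s t, γ = ε₁ * x ^ 2 + 2 * ε₂ * y ^ 2 +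
      4 * (a * s ^ 2 + b * s * t + c * t ^ 2)}
  have hR : ∀ r ∈ R, ∀ z, r * z ^ 2 ∈ R := by
    rintro _ ⟨x, y, s, t, rfl⟩ w
    exact ⟨x * w, y * w, s * w, t * w, by ring⟩
  refine mem_of_forall_not_four_dvd hR ⟨0, 0, 0, 0, by ring⟩ (fun γ hγ => ?_) γ
  have step : ∀ x y k, γ - (ε₁ * x ^ 2 + 2 * ε₂ * y ^ 2) = 4 * k → Odd k → γ ∈ R := by
    intro x y k h hk
    obtain ⟨s, hs⟩ := exists_of_odd (a := a) hb hc hk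
    exact ⟨x, y, s, 1, by linear_combination h - 4 * hs⟩
  rcases odd_or_two_mul_odd hγ with hγ | ⟨δ, hδ, rfl⟩
  · -- an odd number is congruent to `ε₁` or to `ε₁ + 2 ε₂` modulo `4`
    obtain ⟨y, k, hk⟩ : ∃ y k, γ - (ε₁ * 1 ^ 2 + 2 * ε₂ * y ^ 2) = 4 * k := by
      obtain ⟨k, hk⟩ := two_dvd_sub hγ h₁
      rcases even_or_odd k with ⟨k, rfl⟩ | hk'
      · exact ⟨0, k, by linear_combination hk⟩
      · obtain ⟨i, hi⟩ := two_dvd_sub hk' h₂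
        exact ⟨1, i, by linear_combination hk + 2 * hi⟩
    rcases even_or_odd k with ⟨k, rfl⟩ | hk'
    · obtain ⟨u, hu⟩ := (isUnit_of_odd hγ).exists_right_inv
      refine mem_of_eight_mul_dvd hR (r := ε₁ * 1 ^ 2 + 2 * ε₂ * y ^ 2) ⟨1, y, 0, 0, by ring⟩
        ⟨u * k, by linear_combination hk - 8 * k * hu⟩
    · exact step _ _ _ hk hk'
  · obtain ⟨k, hk⟩ := two_dvd_sub hδ h₂
    rcases even_or_odd k with ⟨k, rfl⟩ | hk'
    · refine step 2 1 (2 * k - ε₁) (by linear_combination 2 * hk) ?_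
      obtain ⟨i, rfl⟩ := h₁
      exact ⟨k - i - 1, by ring⟩
    · exact step 0 1 k (by linear_combination 2 * hk) hk'

/-- The representatives of the eight square classes of order at most `1`: being congruent modulo `8`
(for the odd ones) or `16` (for the others) is enough to be in the same class. -/
theorem natCast_class_dvd {g : ℕ} (hg : g ∈ ({1, 3, 5, 7, 2, 6, 10, 14} : Finset ℕ)) :
    (8 * g : ℤ_[2]) ∣ ((if g % 2 = 1 then 8 else 16 : ℕ) : ℤ_[2]) := by
  have key : ∀ d : ℕ, Odd d → (8 * d : ℤ_[2]) ∣ 8 := fun d hd => by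
    obtain ⟨u, hu⟩ := (isUnit_of_odd (x := (d : ℤ_[2])) hd.natCast).exists_right_inv
    exact ⟨u, by linear_combination -8 * hu⟩
  have key2 : ∀ d : ℕ, Odd d → (8 * (2 * d : ℕ) : ℤ_[2]) ∣ 16 := fun d hd => by
    obtain ⟨k, hk⟩ := key d hd
    exact ⟨k, by push_cast; linear_combination 2 * hk⟩
  simp only [Finset.mem_insert, Finset.mem_singleton] at hg
  rcases hg with rfl | rfl | rfl | rfl | rfl | rfl | rfl | rfl
  · exact key 1 (by decide)
  · exact key 3 (by decide)
  · exact key 5 (by decide)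
  · exact key 7 (by decide)
  · exact key2 1 (by decide)
  · exact key2 3 (by decide)
  · exact key2 5 (by decide)
  · exact key2 7 (by decide)

/-- The finite check behind `diagValues_class`. -/
theorem ternary_residues : ∀ m ∈ ({(1, 1), (1, 2), (2, 2), (2, 4)} : Finset (ℕ × ℕ)),
    ∀ d₁ ∈ ({1, 3, 5, 7} : Finset ℕ), ∀ d₂ ∈ ({1, 3, 5, 7} : Finset ℕ),
    ∀ d₃ ∈ ({1, 3, 5, 7} : Finset ℕ), ∃ c ∈ ({1, 3, 5, 7, 2, 6, 10, 14} : Finset ℕ),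
    ∀ g ∈ ({1, 3, 5, 7, 2, 6, 10, 14} : Finset ℕ), g = c ∨
      ∃ x ∈ Finset.range 4, ∃ y ∈ Finset.range 4, ∃ z ∈ Finset.range 4,
        d₁ * x ^ 2 + m.1 * d₂ * y ^ 2 + m.2 * d₃ * z ^ 2 ≡ g
          [MOD if g % 2 = 1 then 8 else 16] := by
  decide +kernel

/-- Each of the diagonal forms `⟨ε₁, ε₂, ε₃⟩`, `⟨ε₁, ε₂, 2ε₃⟩`, `⟨ε₁, 2ε₂, 2ε₃⟩` and
`⟨ε₁, 2ε₂, 4ε₃⟩` with odd `εᵢ` represents all of `ℤ_[2]` outside one square class. -/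
theorem diagValues_class {m : ℕ × ℕ} (hm : m ∈ ({(1, 1), (1, 2), (2, 2), (2, 4)} : Finset (ℕ × ℕ)))
    {ε₁ ε₂ ε₃ : ℤ_[2]} (h₁ : Odd ε₁) (h₂ : Odd ε₂) (h₃ : Odd ε₃) :
    ∃ c : ℤ_[2], c ≠ 0 ∧ c ∣ 2 ∧
      ∀ γ, γ ∈ diagValues ε₁ (m.1 * ε₂) (m.2 * ε₃) ∨ ∃ z ≠ 0, γ = c * z ^ 2 := by
  obtain ⟨d₁, hd₁, w₁, hw₁, rfl⟩ := exists_odd_class h₁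
  obtain ⟨d₂, hd₂, w₂, hw₂, rfl⟩ := exists_odd_class h₂
  obtain ⟨d₃, hd₃, w₃, hw₃, rfl⟩ := exists_odd_class h₃
  obtain ⟨u₁, hu₁⟩ := (isUnit_of_odd hw₁).exists_right_inv
  obtain ⟨u₂, hu₂⟩ := (isUnit_of_odd hw₂).exists_right_inv
  obtain ⟨u₃, hu₃⟩ := (isUnit_of_odd hw₃).exists_right_inv
  obtain ⟨c, hc, hcg⟩ := ternary_residues m hm d₁ hd₁ d₂ hd₂ d₃ hd₃
  have hc2 : (c : ℤ_[2]) ∣ 2 := by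
    have h8 : (8 : ℤ_[2]) ≠ 0 := by norm_num
    obtain ⟨k, hk⟩ := natCast_class_dvd hc
    split_ifs at hk
    · exact ⟨2 * k, mul_left_cancel₀ h8 (by push_cast at hk; linear_combination 2 * hk)⟩
    · exact ⟨k, mul_left_cancel₀ h8 (by push_cast at hk; linear_combination hk)⟩
  have hc0 : (c : ℤ_[2]) ≠ 0 := by
    rintro h
    rw [h] at hc2
    exact two_ne_zero (zero_dvd_iff.1 hc2)
  refine ⟨c, hc0, hc2, mem_or_of_not_four_dvd diagValues_mul_sq ⟨0, 0, 0, by ring⟩ fun γ hγ => ?_⟩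
  obtain ⟨g, hg, w, hw, rfl⟩ : ∃ g ∈ ({1, 3, 5, 7, 2, 6, 10, 14} : Finset ℕ),
      ∃ w, Odd w ∧ γ = g * w ^ 2 := by
    rcases odd_or_two_mul_odd hγ with hγ | ⟨δ, hδ, rfl⟩
    · obtain ⟨d, hd, w, hw, rfl⟩ := exists_odd_class hγ
      refine ⟨d, ?_, w, hw, rfl⟩
      fin_cases hd <;> decide
    · obtain ⟨d, hd, w, hw, rfl⟩ := exists_odd_class hδ
      refine ⟨2 * d, ?_, w, hw, by push_cast; ring⟩
      fin_cases hd <;> decide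
  rcases hcg g hg with rfl | ⟨x, -, y, -, z, -, h⟩
  · exact Or.inr ⟨w, ne_zero_of_odd hw, rfl⟩
  left
  refine diagValues_mul_sq _ (mem_of_eight_mul_dvd diagValues_mul_sq
    (r := ((d₁ * x ^ 2 + m.1 * d₂ * y ^ 2 + m.2 * d₃ * z ^ 2 : ℕ) : ℤ_[2])) ?_ ?_) w
  · refine ⟨u₁ * x, u₂ * y, u₃ * z, ?_⟩
    push_cast
    linear_combination -d₁ * x ^ 2 * (w₁ * u₁ + 1) * hu₁
      - m.1 * d₂ * y ^ 2 * (w₂ * u₂ + 1) * hu₂ - m.2 * d₃ * z ^ 2 * (w₃ * u₃ + 1) * hu₃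
  · refine (natCast_class_dvd hg).trans ?_
    obtain ⟨k, hk⟩ := h.dvd
    refine ⟨k, ?_⟩
    have := congrArg (Int.cast : ℤ → ℤ_[2]) hk
    push_cast at this ⊢
    exact this

/-! ### Orthogonal splittings -/

section

variable {M : Type*} [AddCommGroup M] [Module ℤ_[2] M]

/-- The restriction of `q` to a submodule. -/
noncomputable abbrev restr (q : QuadraticForm ℤ_[2] M) (N : Submodule ℤ_[2] M) :
    QuadraticForm ℤ_[2] N :=
  q.comp N.subtype

variable [Module.Free ℤ_[2] M] [Module.Finite ℤ_[2] M]

/-- A vector `u` with `2 q(u) ∣ b(u, M)` splits off as an orthogonal summand. -/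
theorem exists_split_unary (q : QuadraticForm ℤ_[2] M) {u : M} (hu : q u ≠ 0)
    (h : ∀ x, 2 * q u ∣ polar q u x) :
    ∃ N : Submodule ℤ_[2] M, finrank ℤ_[2] M = finrank ℤ_[2] N + 1 ∧
      (∀ m : M, ∃ (s : ℤ_[2]) (n : N), q m = q u * s ^ 2 + restr q N n) ∧
      ∀ (s : ℤ_[2]) (n : N), (Odd s ∨ IsPrim n) → PrimRep q (q u * s ^ 2 + restr q N n) := by
  let N : Submodule ℤ_[2] M := LinearMap.ker (q.polarBilin u)
  have hN : ∀ n : N, polar q u n = 0 := fun n => n.2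
  have huu : polar q u u = 2 * q u := by rw [polar_self, two_nsmul, two_mul]
  let f : (ℤ_[2] × N) →ₗ[ℤ_[2]] M :=
    (LinearMap.toSpanSingleton ℤ_[2] M u).coprod N.subtype
  have hf : ∀ s n, f (s, n) = s • u + (n : M) := fun s n => by simp [f]
  have hb : ∀ s n, polar q u (f (s, n)) = 2 * q u * s := fun s n => by
    rw [hf, polar_add_right, polar_smul_right, hN, huu]; simp; ring
  have h2u : 2 * q u ≠ 0 := mul_ne_zero two_ne_zero hu
  have hbij : Function.Bijective f := by
    constructor
    · rw [← LinearMap.ker_eq_bot, LinearMap.ker_eq_bot']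
      rintro ⟨s, n⟩ h0
      have hs : s = 0 := by
        have := hb s n
        rw [h0, polar_zero_right] at this
        exact (mul_eq_zero.1 this.symm).resolve_left h2u
      subst hs
      rw [hf, zero_smul, zero_add] at h0
      ext <;> simp [h0]
    · intro x
      obtain ⟨s, hs⟩ := h x
      have hx : x - s • u ∈ N := by
        change polar q u (x - s • u) = 0
        rw [polar_sub_right, polar_smul_right, huu, hs, smul_eq_mul]; ring
      exact ⟨(s, ⟨_, hx⟩), by rw [hf]; simp⟩
  let e := LinearEquiv.ofBijective f hbij
  have hval : ∀ s n, q (f (s, n)) = q u * s ^ 2 + restr q N n := fun s n => by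
    rw [hf, map_smul_add, hN]; simp only [comp_apply, Submodule.subtype_apply]; ring
  refine ⟨N, ?_, fun m => ?_, fun s n hsn => ⟨f (s, n), ?_, hval s n⟩⟩
  · rw [← e.finrank_eq, finrank_prod, finrank_self, add_comm]
  · obtain ⟨⟨s, n⟩, rfl⟩ := hbij.2 m
    exact ⟨s, n, hval s n⟩
  · rintro ⟨w, hw⟩
    obtain ⟨⟨s', n'⟩, rfl⟩ := hbij.2 w
    rw [← map_smul] at hw
    have := hbij.1 hw
    rw [Prod.smul_mk, Prod.mk.injEq] at this
    rcases hsn with hs | hn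
    · exact not_two_dvd_of_odd hs ⟨s', this.1⟩
    · exact hn ⟨n', this.2⟩

/-- A binary block `p (a s² + b s t + c t²)` with `b` odd splits off as an orthogonal summand
when `p` divides all the products of its basis vectors with `M`. -/
theorem exists_split_binary (q : QuadraticForm ℤ_[2] M) {u v : M} {p a b c : ℤ_[2]} (hp : p ≠ 0)
    (hb : Odd b) (hu : q u = p * a) (hv : q v = p * c) (huv : polar q u v = p * b)
    (hdu : ∀ x, p ∣ polar q u x) (hdv : ∀ x, p ∣ polar q v x) :
    ∃ N : Submodule ℤ_[2] M, finrank ℤ_[2] M = finrank ℤ_[2] N + 2 ∧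
      (∀ m : M, ∃ (s t : ℤ_[2]) (n : N),
        q m = p * (a * s ^ 2 + b * s * t + c * t ^ 2) + restr q N n) ∧
      ∀ (s t : ℤ_[2]) (n : N), (Odd s ∨ Odd t ∨ IsPrim n) →
        PrimRep q (p * (a * s ^ 2 + b * s * t + c * t ^ 2) + restr q N n) := by
  let N : Submodule ℤ_[2] M := LinearMap.ker (q.polarBilin u) ⊓ LinearMap.ker (q.polarBilin v)
  have hNu : ∀ n : N, polar q u n = 0 := fun n => n.2.1
  have hNv : ∀ n : N, polar q v n = 0 := fun n => n.2.2
  have huu : polar q u u = p * (2 * a) := by rw [polar_self, hu, two_nsmul]; ring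
  have hvv : polar q v v = p * (2 * c) := by rw [polar_self, hv, two_nsmul]; ring
  have hvu : polar q v u = p * b := by rw [polar_comm, huv]
  obtain ⟨d, hd⟩ : ∃ d, (b ^ 2 - 4 * a * c) * d = 1 := by
    refine (isUnit_of_odd ?_).exists_right_inv
    obtain ⟨k, rfl⟩ := hb
    exact ⟨2 * k ^ 2 + 2 * k - 2 * a * c, by ring⟩
  let f : ((ℤ_[2] × ℤ_[2]) × N) →ₗ[ℤ_[2]] M :=
    ((LinearMap.toSpanSingleton ℤ_[2] M u).coprod
      (LinearMap.toSpanSingleton ℤ_[2] M v)).coprod N.subtype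
  have hf : ∀ s t n, f ((s, t), n) = s • u + (t • v + (n : M)) := fun s t n => by
    simp [f, add_assoc]
  have hbu : ∀ s t n, polar q u (f ((s, t), n)) = p * (2 * a * s + b * t) := fun s t n => by
    rw [hf, polar_add_right, polar_add_right, polar_smul_right, polar_smul_right, hNu, huu, huv]
    simp; ring
  have hbv : ∀ s t n, polar q v (f ((s, t), n)) = p * (b * s + 2 * c * t) := fun s t n => by
    rw [hf, polar_add_right, polar_add_right, polar_smul_right, polar_smul_right, hNv, hvv, hvu]
    simp; ring
  have hbij : Function.Bijective f := by
    constructor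
    · rw [← LinearMap.ker_eq_bot, LinearMap.ker_eq_bot']
      rintro ⟨⟨s, t⟩, n⟩ h0
      have h1 := hbu s t n
      have h2 := hbv s t n
      rw [h0, polar_zero_right] at h1 h2
      have h1 := (mul_eq_zero.1 h1.symm).resolve_left hp
      have h2 := (mul_eq_zero.1 h2.symm).resolve_left hp
      have hs : s = 0 := by linear_combination -s * hd + d * b * h2 - d * 2 * c * h1
      have ht : t = 0 := by linear_combination -t * hd + d * b * h1 - d * 2 * a * h2
      subst hs ht
      rw [hf, zero_smul, zero_smul, zero_add, zero_add] at h0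
      ext <;> simp [h0]
    · intro x
      obtain ⟨k, hk⟩ := hdu x
      obtain ⟨l, hl⟩ := hdv x
      -- Cramer's rule
      let s := d * (b * l - 2 * c * k)
      let t := d * (b * k - 2 * a * l)
      have hx : x - (s • u + t • v) ∈ N := by
        constructor
        · change polar q u _ = 0
          rw [polar_sub_right, polar_add_right, polar_smul_right, polar_smul_right, huu, huv, hk]
          simp only [smul_eq_mul, s, t]
          linear_combination -p * k * hd
        · change polar q v _ = 0
          rw [polar_sub_right, polar_add_right, polar_smul_right, polar_smul_right, hvv, hvu, hl]
          simp only [smul_eq_mul, s, t]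
          linear_combination -p * l * hd
      exact ⟨((s, t), ⟨_, hx⟩), by rw [hf]; simp only; abel⟩
  let e := LinearEquiv.ofBijective f hbij
  have hval : ∀ s t n, q (f ((s, t), n)) = p * (a * s ^ 2 + b * s * t + c * t ^ 2) + restr q N n :=
    fun s t n => by
      rw [hf, map_smul_add, map_smul_add, polar_add_right, polar_smul_right, hNu, hNv, hu, hv, huv,
        smul_eq_mul, comp_apply, Submodule.subtype_apply]
      ring
  refine ⟨N, ?_, fun m => ?_, fun s t n hstn => ⟨f ((s, t), n), ?_, hval s t n⟩⟩
  · rw [← e.finrank_eq, finrank_prod, finrank_prod, finrank_self, add_comm]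
  · obtain ⟨⟨⟨s, t⟩, n⟩, rfl⟩ := hbij.2 m
    exact ⟨s, t, n, hval s t n⟩
  · rintro ⟨w, hw⟩
    obtain ⟨⟨⟨s', t'⟩, n'⟩, rfl⟩ := hbij.2 w
    rw [← map_smul] at hw
    have := hbij.1 hw
    rw [Prod.smul_mk, Prod.smul_mk, Prod.mk.injEq, Prod.mk.injEq] at this
    rcases hstn with hs | ht | hn
    · exact not_two_dvd_of_odd hs ⟨s', this.1.1⟩
    · exact not_two_dvd_of_odd ht ⟨t', this.1.2⟩
    · exact hn ⟨n', this.2⟩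

end

/-! ### Primitive universality over `ℤ_[2]` -/

section

theorem mul_odd_dvd {m ε x : ℤ_[2]} (hε : Odd ε) (h : m ∣ x) : m * ε ∣ x := by
  obtain ⟨k, rfl⟩ := h
  obtain ⟨u, hu⟩ := (isUnit_of_odd hε).exists_right_inv
  exact ⟨u * k, by linear_combination -m * k * hu⟩

theorem eq_mul_odd {m x : ℤ_[2]} (h : m ∣ x) (h2 : ¬ m * 2 ∣ x) : ∃ k, Odd k ∧ x = m * k := by
  obtain ⟨k, rfl⟩ := h
  refine ⟨k, (even_or_odd k).resolve_left ?_, rfl⟩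
  rintro ⟨l, rfl⟩
  exact h2 ⟨l, by ring⟩

/-- A binary form `⟨ε₁, ε₂⟩` with odd coefficients misses a class modulo `4`. -/
theorem exists_ne_mod_four {ε₁ ε₂ : ℤ_[2]} (h₁ : Odd ε₁) (h₂ : Odd ε₂) :
    ∃ γ : ℤ_[2], ∀ x y, ¬ 4 ∣ γ - (ε₁ * x ^ 2 + ε₂ * y ^ 2) := by
  by_contra! h
  have key : ∀ k₁ k₂ : ZMod (2 ^ 2), ∃ g : ZMod (2 ^ 2),
      ∀ x y, g ≠ (2 * k₁ + 1) * x ^ 2 + (2 * k₂ + 1) * y ^ 2 := by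
    decide +kernel
  obtain ⟨k₁, rfl⟩ := h₁
  obtain ⟨k₂, rfl⟩ := h₂
  let f := PadicInt.toZModPow (p := 2) 2
  obtain ⟨g, hg⟩ := key (f k₁) (f k₂)
  obtain ⟨γ, rfl⟩ := ZMod.ringHom_surjective f g
  obtain ⟨x, y, k, hk⟩ := h γ
  apply hg (f x) (f y)
  have h4 : f 4 = 0 := by rw [map_ofNat]; decide
  have := congrArg f hk
  rw [map_mul, h4, zero_mul, map_sub, sub_eq_zero] at this
  simpa only [map_add, map_mul, map_pow, map_ofNat, map_one] using this

/-- A form `⟨ε₁, 2ε₂⟩` misses a class modulo `8`. -/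
theorem exists_ne_mod_eight (ε₁ ε₂ : ℤ_[2]) :
    ∃ γ : ℤ_[2], ∀ x y, ¬ 8 ∣ γ - (ε₁ * x ^ 2 + 2 * ε₂ * y ^ 2) := by
  by_contra! h
  have key : ∀ e₁ e₂ : ZMod (2 ^ 3), ∃ g : ZMod (2 ^ 3),
      ∀ x y, g ≠ e₁ * x ^ 2 + 2 * e₂ * y ^ 2 := by
    decide +kernel
  let f := PadicInt.toZModPow (p := 2) 3
  obtain ⟨g, hg⟩ := key (f ε₁) (f ε₂)
  obtain ⟨γ, rfl⟩ := ZMod.ringHom_surjective f g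
  obtain ⟨x, y, k, hk⟩ := h γ
  apply hg (f x) (f y)
  have h8 : f 8 = 0 := by rw [map_ofNat]; decide
  have := congrArg f hk
  rw [map_mul, h8, zero_mul, map_sub, sub_eq_zero] at this
  simpa only [map_add, map_mul, map_pow, map_ofNat] using this

variable {M : Type*} [AddCommGroup M] [Module ℤ_[2] M]

theorem two_dvd_polar {q : QuadraticForm ℤ_[2] M} (h : ∀ x, 2 ∣ q x) (x y : M) :
    2 ∣ polar q x y := dvd_sub (dvd_sub (h _) (h _)) (h _)

variable [Module.Free ℤ_[2] M] [Module.Finite ℤ_[2] M]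

/-- `exists_isPrim` for a submodule; it spares instance search a chain of nested submodules. -/
theorem exists_isPrim_submodule (N : Submodule ℤ_[2] M) (h : 1 ≤ finrank ℤ_[2] N) :
    ∃ n : N, IsPrim n := exists_isPrim h

/-- The case of an even unimodular block: either a hyperbolic plane splits off, or the block is
anisotropic and is completed by `⟨2ε⟩` or by twice a block. -/
theorem primRep_of_odd_polar {q : QuadraticForm ℤ_[2] M} (hM : 5 ≤ finrank ℤ_[2] M)
    (huniv : ∀ γ, ∃ v, q v = γ) {u v : M} (huv : Odd (polar q u v)) {α : ℤ_[2]} (hα : 4 ∣ α) :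
    PrimRep q α := by
  obtain ⟨N, hN, hval, hprim⟩ := exists_split_binary q (p := 1) one_ne_zero huv (one_mul _).symm
    (one_mul _).symm (one_mul _).symm (fun _ => one_dvd _) (fun _ => one_dvd _)
  generalize q u = a at *
  generalize q v = c at *
  generalize polar q u v = b at *
  by_cases hac : 2 ∣ a ∨ 2 ∣ c
  · obtain ⟨s, t, hst, rfl⟩ := exists_hyperbolic huv hac α
    simpa using hprim s t 0 (hst.elim Or.inl (Or.inr ∘ Or.inl))
  push Not at hac
  have ha := (even_or_odd a).resolve_left hac.1
  have hc := (even_or_odd c).resolve_left hac.2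
  -- from here on the block is anisotropic: it represents the odd numbers, with `t = 1`
  by_cases hodd : ∃ n : N, Odd (restr q N n)
  · obtain ⟨n, hn⟩ := hodd
    have hδ : Odd (α - restr q N n) := by
      obtain ⟨k, rfl⟩ := hα
      obtain ⟨l, hl⟩ := hn
      exact ⟨2 * k - l - 1, by rw [hl]; ring⟩
    obtain ⟨s, hs⟩ := exists_of_odd (a := a) huv hc hδ
    have := hprim s 1 n (Or.inr (Or.inl odd_one))
    rwa [hs, one_mul, sub_add_cancel] at this
  have heven : ∀ n : N, 2 ∣ restr q N n := fun n =>
    (even_or_odd _).resolve_right fun h => hodd ⟨n, h⟩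
  have hpol := two_dvd_polar heven
  by_cases h4 : ∃ x y : N, ¬ 4 ∣ polar (restr q N) x y
  · obtain ⟨x, y, hxy⟩ := h4
    obtain ⟨b', hb', hxy⟩ := eq_mul_odd (hpol x y) (by norm_num; exact hxy)
    obtain ⟨a', ha'⟩ := heven x
    obtain ⟨c', hc'⟩ := heven y
    obtain ⟨N', hN', hval', hprim'⟩ := exists_split_binary (restr q N) two_ne_zero hb' ha' hc' hxy
      (hpol x) (hpol y)
    have lift : ∀ {β γ}, PrimRep (restr q N) β →
        (∃ s t, γ = 1 * (a * s ^ 2 + b * s * t + c * t ^ 2) + β) → PrimRep q γ := by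
      rintro _ _ ⟨n, hn, rfl⟩ ⟨s, t, rfl⟩
      exact hprim s t n (Or.inr (Or.inr hn))
    by_cases hac' : 2 ∣ a' ∨ 2 ∣ c'
    · obtain ⟨β, rfl⟩ := hα
      obtain ⟨s, t, hst, hβ⟩ := exists_hyperbolic hb' hac' (2 * β)
      refine lift (hprim' s t 0 (hst.elim Or.inl (Or.inr ∘ Or.inl))) ⟨0, 0, ?_⟩
      rw [hβ]
      simp
      ring
    push Not at hac'
    have hc'o := (even_or_odd c').resolve_left hac'.2
    obtain ⟨n, hn⟩ := exists_isPrim_submodule N' (by omega)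
    obtain ⟨s, t, s', t', h⟩ := two_blocks_universal (a := a) (a' := a') huv hc hb' hc'o
      (α - restr (restr q N) N' n)
    exact lift (hprim' s' t' n (Or.inr (Or.inr hn))) ⟨s, t, by linear_combination h⟩
  push Not at h4
  -- a value `2` needs a vector `n` of `N` with `q n = 2 ε`, and this vector splits off
  obtain ⟨m, hm⟩ := huniv 2
  obtain ⟨s, t, n, hn⟩ := hval m
  obtain ⟨ε, hε, hnε⟩ : ∃ ε, Odd ε ∧ restr q N n = 2 * ε := by
    obtain ⟨k, hk⟩ := heven n
    obtain ⟨⟨s, rfl⟩, ⟨t, rfl⟩⟩ := even_of_block_even (s := s) (t := t) ha huv hc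
      ⟨1 - k, by linear_combination hm - hn - hk⟩
    refine ⟨1 - 2 * (a * s ^ 2 + b * s * t + c * t ^ 2),
      ⟨-(a * s ^ 2 + b * s * t + c * t ^ 2), by ring⟩, by linear_combination hm - hn⟩
  have h2ε : 2 * ε ≠ 0 := mul_ne_zero two_ne_zero (ne_zero_of_odd hε)
  obtain ⟨N', hN', hval', hprim'⟩ := exists_split_unary (restr q N) (u := n) (by rwa [hnε])
    (fun x => by
      rw [hnε, ← mul_assoc]
      exact mul_odd_dvd hε (by norm_num; exact h4 n x))
  rw [hnε] at hval' hprim'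
  obtain ⟨r, ⟨s, t, z, rfl⟩, n', hn', rfl⟩ := exists_isPrim_sub_mem (q := restr (restr q N) N')
    (c := 2 * (5 * ε)) (by omega) blockValues_mul_sq
    (mul_ne_zero two_ne_zero (ne_zero_of_odd (odd_five_mul hε)))
    (dvd_two_of_odd (odd_five_mul hε)).2
    (blockValues_one (a := a) huv hc hε) (by
      obtain ⟨m, hm⟩ := huniv (2 * (5 * ε))
      obtain ⟨s, t, n, hn⟩ := hval m
      obtain ⟨z, n', hn'⟩ := hval' n
      exact ⟨_, ⟨s, t, z, rfl⟩, n', by linear_combination hn' + hn - hm⟩) hα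
  obtain ⟨w, hw, hwe⟩ := hprim' z n' (Or.inr hn')
  have := hprim s t w (Or.inr (Or.inr hw))
  rwa [hwe, ← add_assoc] at this

/-- The case where twice an even unimodular block splits off. -/
theorem primRep_of_polar_eq_two_mul_odd {q : QuadraticForm ℤ_[2] M} (hM : 5 ≤ finrank ℤ_[2] M)
    (huniv : ∀ γ, ∃ v, q v = γ) (hpol : ∀ x y, 2 ∣ polar q x y) {u v : M} (hu : 2 ∣ q u)
    (hv : 2 ∣ q v) (huv : ¬ 4 ∣ polar q u v) {α : ℤ_[2]} (hα : 4 ∣ α) : PrimRep q α := by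
  obtain ⟨b, hb, hxy⟩ := eq_mul_odd (hpol u v) (by norm_num; exact huv)
  obtain ⟨a, ha⟩ := hu
  obtain ⟨c, hc⟩ := hv
  obtain ⟨N, hN, hval, hprim⟩ := exists_split_binary q two_ne_zero hb ha hc hxy
    (hpol u) (hpol v)
  by_cases hac : 2 ∣ a ∨ 2 ∣ c
  · obtain ⟨β, rfl⟩ := hα
    obtain ⟨s, t, hst, hβ⟩ := exists_hyperbolic hb hac (2 * β)
    have := hprim s t 0 (hst.elim Or.inl (Or.inr ∘ Or.inl))
    rw [hβ, map_zero, add_zero] at this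
    convert this using 1
    ring
  push Not at hac
  have hco := (even_or_odd c).resolve_left hac.2
  -- the value `1` needs an odd value on `N`
  obtain ⟨m, hm⟩ := huniv 1
  obtain ⟨s, t, n, hn⟩ := hval m
  have hε : Odd (restr q N n) :=
    ⟨-(a * s ^ 2 + b * s * t + c * t ^ 2), by linear_combination hm - hn⟩
  obtain ⟨N', hN', hval', hprim'⟩ := exists_split_unary (restr q N) (u := n) (ne_zero_of_odd hε)
    (fun x => mul_odd_dvd hε (by simpa [polar] using hpol n x))
  obtain ⟨r, ⟨s, t, z, rfl⟩, n', hn', rfl⟩ := exists_isPrim_sub_mem (q := restr (restr q N) N')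
    (c := 5 * restr q N n) (by omega) blockValues_mul_sq
    (ne_zero_of_odd (odd_five_mul hε)) (dvd_two_of_odd (odd_five_mul hε)).1
    (blockValues_two (a := a) hb hco hε) (by
      obtain ⟨m, hm⟩ := huniv (5 * restr q N n)
      obtain ⟨s, t, n, hn⟩ := hval m
      obtain ⟨z, n', hn'⟩ := hval' n
      exact ⟨_, ⟨s, t, z, rfl⟩, n', by linear_combination hn' + hn - hm⟩) hα
  obtain ⟨w, hw, hwe⟩ := hprim' z n' (Or.inr hn')
  have := hprim s t w (Or.inr (Or.inr hw))
  rwa [hwe, ← add_assoc] at this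

/-- The case where a diagonal ternary form as in `diagValues_class` splits off. The binary part
`⟨ε₁, m₁ε₂⟩` has been split off already, with complement `q'`, and `e` spans the third component. -/
theorem primRep_of_diag {M' : Type*} [AddCommGroup M'] [Module ℤ_[2] M']
    {q : QuadraticForm ℤ_[2] M'} (huniv : ∀ γ, ∃ v, q v = γ) {q' : QuadraticForm ℤ_[2] M}
    (hM : 3 ≤ finrank ℤ_[2] M) {m : ℕ × ℕ}
    (hm : m ∈ ({(1, 1), (1, 2), (2, 2), (2, 4)} : Finset (ℕ × ℕ)))
    {ε₁ ε₂ ε₃ : ℤ_[2]} (h₁ : Odd ε₁) (h₂ : Odd ε₂) (h₃ : Odd ε₃)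
    (hval : ∀ v, ∃ x y n, q v = ε₁ * x ^ 2 + m.1 * ε₂ * y ^ 2 + q' n)
    (hprim : ∀ x y n, IsPrim n → PrimRep q (ε₁ * x ^ 2 + m.1 * ε₂ * y ^ 2 + q' n))
    {e : M} (he : q' e = m.2 * ε₃) (hpol : ∀ x, (2 * m.2 : ℤ_[2]) ∣ polar q' e x)
    {α : ℤ_[2]} (hα : 4 ∣ α) : PrimRep q α := by
  have hm0 : (m.2 : ℤ_[2]) ≠ 0 := by
    fin_cases hm <;> norm_num
  obtain ⟨N, hN, hval', hprim'⟩ := exists_split_unary q' (u := e)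
    (by rw [he]; exact mul_ne_zero hm0 (ne_zero_of_odd h₃))
    (fun x => by rw [he, ← mul_assoc]; exact mul_odd_dvd h₃ (hpol x))
  rw [he] at hval' hprim'
  obtain ⟨c, hc0, hc2, hc⟩ := diagValues_class hm h₁ h₂ h₃
  obtain ⟨r, ⟨x, y, z, rfl⟩, n, hn, rfl⟩ := exists_isPrim_sub_mem (q := restr q' N)
    (by omega) diagValues_mul_sq hc0 hc2 hc (by
      obtain ⟨v, hv⟩ := huniv c
      obtain ⟨x, y, n, hn⟩ := hval v
      obtain ⟨z, n', hn'⟩ := hval' n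
      exact ⟨_, ⟨x, y, z, rfl⟩, n', by linear_combination hn' + hn - hv⟩) hα
  obtain ⟨w, hw, hwe⟩ := hprim' z n (Or.inr hn)
  have := hprim x y w hw
  rwa [hwe, ← add_assoc] at this

/-- The remaining case: vectors with even values pair to multiples of `4`, and unary components are
split off one after the other. -/
theorem primRep_of_four_dvd_polar {q : QuadraticForm ℤ_[2] M} (hM : 5 ≤ finrank ℤ_[2] M)
    (huniv : ∀ γ, ∃ v, q v = γ) (hpol2 : ∀ x y, 2 ∣ polar q x y)
    (hpol4 : ∀ x y, 2 ∣ q x → 2 ∣ q y → 4 ∣ polar q x y) {α : ℤ_[2]} (hα : 4 ∣ α) :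
    PrimRep q α := by
  obtain ⟨u, hu⟩ := huniv 1
  obtain ⟨ε₁, hε₁, h₁⟩ : ∃ ε₁, q u = ε₁ ∧ Odd ε₁ := ⟨1, hu, odd_one⟩
  obtain ⟨N₁, hN₁, hval₁, hprim₁⟩ := exists_split_unary q (u := u)
    (by rw [hε₁]; exact ne_zero_of_odd h₁) (fun x => by rw [hε₁]; exact mul_odd_dvd h₁ (hpol2 u x))
  rw [hε₁] at hval₁ hprim₁
  have hp2 : ∀ x y, 2 ∣ polar (restr q N₁) x y := fun x y => by
    simpa [polar] using hpol2 x y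
  have hp4 : ∀ x y, 2 ∣ restr q N₁ x → 2 ∣ restr q N₁ y → 4 ∣ polar (restr q N₁) x y :=
    fun x y hx hy => by simpa [polar] using hpol4 x y hx hy
  generalize restr q N₁ = q₁ at *
  -- `q = ⟨ε₁⟩ ⊥ q₁`
  by_cases hodd : ∃ v, Odd (q₁ v)
  · obtain ⟨v, h₂⟩ := hodd
    obtain ⟨N₂, hN₂, hval₂, hprim₂⟩ := exists_split_unary q₁ (u := v) (ne_zero_of_odd h₂)
      (fun x => mul_odd_dvd h₂ (hp2 v x))
    have hp2' : ∀ x y, 2 ∣ polar (restr q₁ N₂) x y := fun x y => by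
      simpa [polar] using hp2 x y
    have hp4' : ∀ x y, 2 ∣ restr q₁ N₂ x → 2 ∣ restr q₁ N₂ y → 4 ∣ polar (restr q₁ N₂) x y :=
      fun x y hx hy => by simpa [polar] using hp4 x y hx hy
    generalize restr q₁ N₂ = q₂ at *
    have hval : ∀ w, ∃ x y n, q w = ε₁ * x ^ 2 + (1 : ℕ) * q₁ v * y ^ 2 + q₂ n := fun w => by
      obtain ⟨x, n, h⟩ := hval₁ w
      obtain ⟨y, n', h'⟩ := hval₂ n
      exact ⟨x, y, n', by rw [h, h', Nat.cast_one]; ring⟩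
    have hprim : ∀ x y n, IsPrim n →
        PrimRep q (ε₁ * x ^ 2 + (1 : ℕ) * q₁ v * y ^ 2 + q₂ n) := fun x y n hn => by
      obtain ⟨w, hw, hwe⟩ := hprim₂ y n (Or.inr hn)
      have := hprim₁ x w (Or.inr hw)
      rwa [hwe, ← add_assoc, ← one_mul (q₁ v), ← Nat.cast_one (R := ℤ_[2])] at this
    by_cases hodd' : ∃ e, Odd (q₂ e)
    · obtain ⟨e, h₃⟩ := hodd'
      exact primRep_of_diag (m := (1, 1)) huniv (by omega) (by decide) h₁ h₂ h₃ hval hprim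
        (e := e) (by simp) (fun x => by simpa using hp2' e x) hα
    have heven : ∀ n, 2 ∣ q₂ n := fun n => (even_or_odd _).resolve_right fun h => hodd' ⟨n, h⟩
    -- a class modulo `4` missed by `⟨ε₁, ε₂⟩` needs a value of `q₂` that is not divisible by `4`
    obtain ⟨γ, hγ⟩ := exists_ne_mod_four h₁ h₂
    obtain ⟨w, rfl⟩ := huniv γ
    obtain ⟨x, y, e, he⟩ := hval w
    have h4 : ¬ 4 ∣ q₂ e := fun h => hγ x y (by
      rw [he, Nat.cast_one, one_mul, add_sub_cancel_left]; exact h)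
    obtain ⟨ε₃, h₃, he₃⟩ := eq_mul_odd (heven e) (by norm_num; exact h4)
    exact primRep_of_diag (m := (1, 2)) huniv (by omega) (by decide) h₁ h₂ h₃ hval hprim
      (e := e) (by simpa using he₃)
      (fun x => by norm_num; exact hp4' e x (heven _) (heven _)) hα
  have heven : ∀ n, 2 ∣ q₁ n := fun n => (even_or_odd _).resolve_right fun h => hodd ⟨n, h⟩
  have hp4 : ∀ x y, 4 ∣ polar q₁ x y := fun x y => hp4 x y (heven x) (heven y)
  obtain ⟨v, ε₂, h₂, hv⟩ : ∃ v ε₂, Odd ε₂ ∧ q₁ v = 2 * ε₂ := by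
    obtain ⟨γ, hγ⟩ := exists_ne_mod_four h₁ h₁
    obtain ⟨w, rfl⟩ := huniv γ
    obtain ⟨x, e, he⟩ := hval₁ w
    have h4 : ¬ 4 ∣ q₁ e := fun h => hγ x 0 (by
      rw [he, zero_pow two_ne_zero, mul_zero, add_zero, add_sub_cancel_left]; exact h)
    exact ⟨e, eq_mul_odd (heven e) (by norm_num; exact h4)⟩
  obtain ⟨N₂, hN₂, hval₂, hprim₂⟩ := exists_split_unary q₁ (u := v)
    (by rw [hv]; exact mul_ne_zero two_ne_zero (ne_zero_of_odd h₂))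
    (fun x => by rw [hv, ← mul_assoc]; exact mul_odd_dvd h₂ (by norm_num; exact hp4 v x))
  rw [hv] at hval₂ hprim₂
  have hp4' : ∀ x y, 4 ∣ polar (restr q₁ N₂) x y := fun x y => by
    simpa [polar] using hp4 x y
  have heven' : ∀ n, 2 ∣ restr q₁ N₂ n := fun n => heven n
  generalize restr q₁ N₂ = q₂ at *
  have hval : ∀ w, ∃ x y n, q w = ε₁ * x ^ 2 + (2 : ℕ) * ε₂ * y ^ 2 + q₂ n := fun w => by
    obtain ⟨x, n, h⟩ := hval₁ w
    obtain ⟨y, n', h'⟩ := hval₂ n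
    exact ⟨x, y, n', by rw [h, h', Nat.cast_ofNat]; ring⟩
  have hprim : ∀ {x y β}, PrimRep q₂ β →
      PrimRep q (ε₁ * x ^ 2 + (2 : ℕ) * ε₂ * y ^ 2 + β) := by
    rintro x y _ ⟨n, hn, rfl⟩
    obtain ⟨w, hw, hwe⟩ := hprim₂ y n (Or.inr hn)
    have := hprim₁ x w (Or.inr hw)
    rwa [hwe, ← add_assoc, ← Nat.cast_ofNat (R := ℤ_[2])] at this
  -- `q = ⟨ε₁, 2ε₂⟩ ⊥ q₂`
  by_cases h4 : ∃ e, ¬ 4 ∣ q₂ e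
  · obtain ⟨e, he⟩ := h4
    obtain ⟨ε₃, h₃, he₃⟩ := eq_mul_odd (heven' e) (by norm_num; exact he)
    exact primRep_of_diag (m := (2, 2)) huniv (by omega) (by decide) h₁ h₂ h₃ hval
      (fun x y n hn => hprim ⟨n, hn, rfl⟩) (e := e) (by simpa using he₃)
      (fun x => by norm_num; exact hp4' e x) hα
  push Not at h4
  by_cases h8 : ∃ x y, ¬ 8 ∣ polar q₂ x y
  · obtain ⟨x, y, hxy⟩ := h8
    obtain ⟨b, hb, hxy⟩ := eq_mul_odd (hp4' x y) (by norm_num; exact hxy)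
    obtain ⟨a, ha⟩ := h4 x
    obtain ⟨c, hc⟩ := h4 y
    obtain ⟨N, hN, -, hprim'⟩ := exists_split_binary q₂ (p := 4) (by norm_num) hb ha hc hxy
      (hp4' x) (hp4' y)
    by_cases hac : 2 ∣ a ∨ 2 ∣ c
    · obtain ⟨β, rfl⟩ := hα
      obtain ⟨s, t, hst, hβ⟩ := exists_hyperbolic hb hac β
      have := hprim (x := 0) (y := 0) (hprim' s t 0 (hst.elim Or.inl (Or.inr ∘ Or.inl)))
      rw [hβ, map_zero, add_zero] at this
      convert this using 1
      ring
    push Not at hac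
    have hco := (even_or_odd c).resolve_left hac.2
    obtain ⟨n, hn⟩ := exists_isPrim_submodule N (by omega)
    obtain ⟨x, y, s, t, h⟩ := diag_add_block_universal (a := a) h₁ h₂ hb hco (α - restr q₂ N n)
    have := hprim (x := x) (y := y) (hprim' s t n (Or.inr (Or.inr hn)))
    convert this using 1
    push_cast
    linear_combination h
  push Not at h8
  obtain ⟨γ, hγ⟩ := exists_ne_mod_eight ε₁ ε₂
  obtain ⟨w, rfl⟩ := huniv γ
  obtain ⟨x, y, e, he⟩ := hval w
  have he8 : ¬ 8 ∣ q₂ e := fun h => hγ x y (by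
    rw [he, Nat.cast_ofNat, add_sub_cancel_left]; exact h)
  obtain ⟨ε₃, h₃, he₃⟩ := eq_mul_odd (h4 e) (by norm_num; exact he8)
  exact primRep_of_diag (m := (2, 4)) huniv (by omega) (by decide) h₁ h₂ h₃ hval
    (fun x y n hn => hprim ⟨n, hn, rfl⟩) (e := e) (by simpa using he₃)
    (fun x => by norm_num; exact h8 e x) hα

/-- A universal quadratic form over `ℤ_[2]` of rank at least `5` is primitively universal. -/
theorem primRep_of_universal {q : QuadraticForm ℤ_[2] M} (hM : 5 ≤ finrank ℤ_[2] M)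
    (huniv : ∀ γ, ∃ v, q v = γ) (α : ℤ_[2]) : PrimRep q α := by
  by_cases hα : 4 ∣ α
  swap
  · obtain ⟨v, rfl⟩ := huniv α
    exact ⟨v, isPrim_of_not_four_dvd hα, rfl⟩
  by_cases hodd : ∃ x y, Odd (polar q x y)
  · obtain ⟨x, y, hxy⟩ := hodd
    exact primRep_of_odd_polar hM huniv hxy hα
  have hpol : ∀ x y, 2 ∣ polar q x y := fun x y =>
    (even_or_odd _).resolve_right fun h => hodd ⟨x, y, h⟩
  by_cases h4 : ∀ x y, 2 ∣ q x → 2 ∣ q y → 4 ∣ polar q x y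
  · exact primRep_of_four_dvd_polar hM huniv hpol h4 hα
  push Not at h4
  obtain ⟨x, y, hx, hy, hxy⟩ := h4
  exact primRep_of_polar_eq_two_mul_odd hM huniv hpol hx hy hxy hα

end

end TwoAdic

/-! ### Lattices in quadratic spaces -/

theorem proposition5p12 {V : Type*} [AddCommGroup V] [Module ℚ_[2] V] [FiniteDimensional ℚ_[2] V]
    [Module ℤ_[2] V] [IsScalarTower ℤ_[2] ℚ_[2] V]
    (Q : QuadraticForm ℚ_[2] V) (hQ : (QuadraticMap.associated (R := ℚ_[2]) Q).Nondegenerate)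
    (L : Submodule ℤ_[2] V) (hfg : L.FG) (hint : QuadLattice.IsIntegral Q L)
    (hrank : 5 ≤ Module.finrank ℤ_[2] L) (huniv : QuadLattice.IsUniversal Q L) :
    QuadLattice.IsPrimitivelyUniversal Q L := by
  have hinj : Function.Injective (algebraMap ℤ_[2] ℚ_[2]) := FaithfulSMul.algebraMap_injective _ _
  have hfin : Module.Finite ℤ_[2] L := Module.Finite.iff_fg.2 hfg
  have htf : Module.IsTorsionFree ℤ_[2] V := Module.IsTorsionFree.trans_faithfulSMul ℤ_[2] ℚ_[2] V
  have hfree : Module.Free ℤ_[2] L := inferInstance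
  -- `Q` restricted to `L`, as a quadratic form with values in `ℤ_[2]`
  choose g hg using fun v : L => hint ⟨v, v.2, rfl⟩
  have hpol : ∀ x y : L, algebraMap ℤ_[2] ℚ_[2] (QuadraticMap.polar g x y) =
      QuadraticMap.polar Q x y := fun x y => by
    simp only [QuadraticMap.polar, map_sub, hg, Submodule.coe_add]
  let q : QuadraticForm ℤ_[2] L := QuadraticMap.ofPolar g
    (fun a x => hinj (by
      rw [hg, smul_eq_mul, map_mul, map_mul, hg, Submodule.coe_smul,
        ← algebraMap_smul ℚ_[2] a (x : V), Q.map_smul, smul_eq_mul]))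
    (fun x x' y => hinj (by
      simp only [map_add, hpol, Submodule.coe_add, QuadraticMap.polar_add_left]))
    (fun a x y => hinj (by
      rw [hpol, smul_eq_mul, map_mul, hpol, Submodule.coe_smul,
        ← algebraMap_smul ℚ_[2] a (x : V), QuadraticMap.polar_smul_left, smul_eq_mul]))
  have hq : ∀ γ, ∃ v, q v = γ := fun γ => by
    obtain ⟨v, hv, hvγ⟩ := huniv.ge ⟨γ, rfl⟩
    exact ⟨⟨v, hv⟩, hinj (by rw [← hvγ]; exact hg _)⟩
  intro a _
  obtain ⟨v, hv, rfl⟩ := TwoAdic.primRep_of_universal hrank hq a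
  refine ⟨v, ⟨v.2, ?_⟩, (hg v).symm⟩
  ext α
  constructor
  · intro hα
    by_contra hα'
    have hα1 : 1 < ‖α‖ := by
      by_contra! hle
      exact hα' ⟨⟨α, hle⟩, rfl⟩
    have hα0 : α ≠ 0 := norm_pos_iff.1 (one_pos.trans hα1)
    have hlt : ‖α⁻¹‖ < 1 := by rw [norm_inv]; exact inv_lt_one_of_one_lt₀ hα1
    -- `α⁻¹ = 2 t` with `t` integral, so `v / 2 = t • (α • v)` lies in `L`
    obtain ⟨t, ht⟩ := (TwoAdic.even_or_odd (⟨α⁻¹, hlt.le⟩ : ℤ_[2])).resolve_right fun h =>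
      hlt.ne (PadicInt.isUnit_iff.1 (TwoAdic.isUnit_of_odd h))
    have ht' : α⁻¹ = 2 * algebraMap ℤ_[2] ℚ_[2] t := by
      have := congrArg (algebraMap ℤ_[2] ℚ_[2]) ht
      rwa [map_mul, map_ofNat] at this
    refine hv ⟨⟨t • α • (v : V), L.smul_mem t hα⟩, Subtype.ext ?_⟩
    change (v : V) = (2 : ℤ_[2]) • t • α • (v : V)
    rw [← algebraMap_smul ℚ_[2] t, ← algebraMap_smul ℚ_[2] (2 : ℤ_[2]),
      smul_smul, smul_smul, map_ofNat, ← ht', inv_mul_cancel₀ hα0, one_smul]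
  · rintro ⟨r, rfl⟩
    rw [Set.mem_ofPred_eq, algebraMap_smul]
    exact L.smul_mem r v.2
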